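/- **Quantum PAC learning of DNF under the uniform distribution with $\tilde O(s^3/\epsilon+s^2/\epsilon^2)$ quantum membership queries.** A DNF formula of size $s$ over $n$ Boolean variables is a disjunction of at most $s$ terms, each term being a conjunction of literals (variables or negated variables). For $f:\{0,1\}^n\to\{0,1\}$, the quantum membership oracle of $f$ is the unitary $|x,b\rangle\mapsto|x,b\oplus f(x)\rangle$. A quantum algorithm with $T$ quantum membership queries starts in a fixed basis state on finitely many qubits, alternates unitaries that do not depend on $f$ with $T$ applications of the oracle, then measures in the computational basis and outputs a hypothesis $h:\{0,1\}^n\to\{0,1\}$ determined by the outcome. There are an absolute constant $C>0$ and an absolute exponent $k\in\mathbb N$ such that for all integers $n\ge 0$ and $s\ge 1$ and all real $\epsilon,\delta\in(0,1)$ there is such an algorithm that makes $$T\;\le\; C\left(\frac{s^3}{\epsilon}+\frac{s^2}{\epsilon^2}\right)\left(\log\frac{2s}{\epsilon\delta}\right)^{k}$$ queries (a bound independent of $n$) and that, for every $f:\{0,1\}^n\to\{0,1\}$ computed by a DNF formula of size $s$, outputs with probability at least $1-\delta$ a hypothesis $h$ with $\Pr_{x}[f(x)\ne h(x)]<\epsilon$,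 where $x$ is uniform on $\{0,1\}^n$. -/

import Mathlib

namespace QDNF

/-- The Boolean cube `{0,1}ⁿ`. -/
abbrev Cube (n : ℕ) : Type := Fin n → Bool

/-- A literal `(i, b)` is satisfied by `x` iff `x i = b`: it is the variable `x i` if `b` is `true`
and its negation if `b` is `false`. A term is the conjunction of a finite set of literals. -/
abbrev Term (n : ℕ) : Type := Finset (Fin n × Bool)

/-- The value of a term at an assignment. -/
def Term.eval {n : ℕ} (t : Term n) (x : Cube n) : Bool :=
  decide (∀ l ∈ t, x l.1 = l.2)

/-- A DNF expression is a disjunction of terms, given as the list of its terms. Its size is the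
length of the list. -/
abbrev DNF (n : ℕ) : Type := List (Term n)

/-- The Boolean function computed by a DNF expression. -/
def DNF.eval {n : ℕ} (φ : DNF n) (x : Cube n) : Bool :=
  φ.any fun t => t.eval x

/-- `f` is computed by a DNF expression with at most `s` terms. -/
def HasDNFSize {n : ℕ} (s : ℕ) (f : Cube n → Bool) : Prop :=
  ∃ φ : DNF n, φ.length ≤ s ∧ ∀ x, φ.eval x = f x

/-- `Pr[f(x) ≠ h(x)]` for a uniformly random `x ∈ {0,1}ⁿ`. -/
noncomputable def disagreement {n : ℕ} (f h : Cube n → Bool) : ℝ :=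
  ((Finset.univ.filter fun x : Cube n => f x ≠ h x).card : ℝ) / 2 ^ n

/-- The computational basis: `n` qubits that hold the query point, one qubit that receives the
oracle's answer, and `w` qubits of workspace. -/
abbrev QBasis (n w : ℕ) : Type := Cube n × Bool × (Fin w → Bool)

/-- The state with amplitude `1` at the all-zero basis vector. -/
def zeroState (n w : ℕ) : QBasis n w → ℂ :=
  Pi.single (fun _ => false, false, fun _ => false) 1

/-- The quantum membership oracle `|x, b, z⟩ ↦ |x, b ⊕ f(x), z⟩`, acting on amplitudes
(it is its own inverse). -/
def membershipQuery {n w : ℕ} (f : Cube n → Bool) (ψ : QBasis n w → ℂ) : QBasis n w → ℂ :=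
  fun v => ψ (v.1, xor v.2.1 (f v.1), v.2.2)

/-- A quantum algorithm with membership queries to an unknown function on `{0,1}ⁿ`: it starts in
the all-zero state, applies `gate 0`, then `queries` times a query followed by the next gate,
measures all qubits in the computational basis, and outputs the hypothesis that `output` assigns
to the outcome. Nothing but the queries depends on the unknown function. -/
structure QuantumLearner (n : ℕ) where
  /-- the number of workspace qubits -/
  work : ℕ
  /-- the number of membership queries -/
  queries : ℕ
  /-- the unitary transformations between the queries; those of index above `queries` are unused -/
  gate : ℕ → Matrix.unitaryGroup (QBasis n work) ℂ
  /-- the hypothesis returned for each measurement outcome -/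
  output : QBasis n work → Cube n → Bool

/-- The state after `t` queries and the gate that follows the last of them. -/
def QuantumLearner.state {n : ℕ} (A : QuantumLearner n) (f : Cube n → Bool) :
    ℕ → QBasis n A.work → ℂ
  | 0 => Matrix.mulVec (A.gate 0 : Matrix (QBasis n A.work) (QBasis n A.work) ℂ)
      (zeroState n A.work)
  | t + 1 => Matrix.mulVec (A.gate (t + 1) : Matrix (QBasis n A.work) (QBasis n A.work) ℂ)
      (membershipQuery f (A.state f t))

open Classical in
/-- The probability that the hypothesis output by `A` with oracle `f` satisfies `P`. -/
noncomputable def QuantumLearner.probOutput {n : ℕ} (A : QuantumLearner n) (f : Cube n → Bool)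
    (P : (Cube n → Bool) → Prop) : ℝ :=
  ∑ v : QBasis n A.work, if P (A.output v) then ‖A.state f A.queries v‖ ^ 2 else 0

/-- `A` learns DNF of size `s` under the uniform distribution with accuracy `ε` and
confidence `δ`. -/
def QuantumLearner.LearnsDNF {n : ℕ} (A : QuantumLearner n) (s : ℕ) (ε δ : ℝ) : Prop :=
  ∀ f : Cube n → Bool, HasDNFSize s f →
    1 - δ ≤ A.probOutput f fun h => disagreement f h < ε

end QDNF

/-! One query turns a uniform superposition of points into the quantum example `2^(-n/2) ∑ₓ |x,
f(x)⟩`. A Hadamard transform of its query point (Fourier sampling) yields a set containing `i` with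
probability half the influence of `i` (`sum_fourier_mem`); an undisturbed example yields a classical
pair `(x, f(x))`. The learner uses `m₁` examples of the first kind and `m₂` of the second. Only
queries are counted, so exhaustive search is free.

Dropping terms wider than `w ≈ log(s/(εδ))` changes little and leaves at most `s * w` variables.
Among these, each of influence at least `τ = ε/(8sw)` is likely to be seen in the Fourier samples;
the others can be fixed to suitable constants at a cost bounded by the sum of their influences
(`exists_relevant`). Hence some narrow DNF over the variables seen is `ε/4`-close to `f`. Chernoff
and union bounds over these DNFs make the one with fewest errors on the classical examples
`ε`-close.

The bound is free of `n` because an `s`-term DNF has total influence at most `2s`: a Fourier sample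
has expected size at most `s`, and discarding samples larger than `d` leaves at most `m₁ * d`
candidate variables. The count obtained is of order `(s/ε + s/ε²) log²`, which is stronger than
required. -/

namespace QDNF

open Matrix

/-! ### Quantum examples and Fourier sampling -/

/-- The query register: a query point together with the qubit that receives the answer. -/
abbrev Reg (n : ℕ) : Type := Cube n × Bool

/-- The entries of the one-qubit Hadamard gate. -/
noncomputable def hadamardEntry (a b : Bool) : ℂ :=
  ((√2)⁻¹ : ℝ) * (if a && b then -1 else 1)

/-- The Hadamard transform on `n` qubits. -/
noncomputable def hadamard (n : ℕ) : Matrix (Cube n) (Cube n) ℂ :=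
  fun x y => ∏ i, hadamardEntry (x i) (y i)

theorem sum_hadamardEntry_mul_star (a c : Bool) :
    ∑ b, hadamardEntry a b * star (hadamardEntry c b) = if a = c then 1 else 0 := by
  have h : ((√2 : ℝ) : ℂ)⁻¹ * ((√2 : ℝ) : ℂ)⁻¹ = 1 / 2 := by
    rw [← mul_inv, ← Complex.ofReal_mul, Real.mul_self_sqrt (by norm_num)]
    norm_num
  cases a <;> cases c <;> simp [hadamardEntry, h]
  norm_num

theorem hadamard_mem_unitaryGroup (n : ℕ) : hadamard n ∈ unitaryGroup (Cube n) ℂ := by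
  rw [mem_unitaryGroup_iff]
  ext x z
  simp only [mul_apply, star_apply, hadamard, star_prod, ← Finset.prod_mul_distrib]
  have h := Finset.prod_univ_sum (fun _ : Fin n => (Finset.univ : Finset Bool))
    (fun i b => hadamardEntry (x i) b * star (hadamardEntry (z i) b))
  rw [Fintype.piFinset_univ] at h
  rw [← h]
  simp only [sum_hadamardEntry_mul_star, one_apply]
  by_cases hxz : x = z
  · simp [hxz]
  · obtain ⟨i, hi⟩ := Function.ne_iff.1 hxz
    rw [if_neg hxz]
    exact Finset.prod_eq_zero (Finset.mem_univ i) (if_neg hi)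

/-- The point `x` with its `i`-th bit negated. -/
def flipBit {n : ℕ} (i : Fin n) (x : Cube n) : Cube n := Function.update x i (!x i)

theorem flipBit_flipBit {n : ℕ} (i : Fin n) (x : Cube n) : flipBit i (flipBit i x) = x := by
  simp [flipBit]

/-- Negation of the `i`-th bit as a permutation of the cube. -/
def flipBitEquiv {n : ℕ} (i : Fin n) : Equiv.Perm (Cube n) :=
  ⟨flipBit i, flipBit i, flipBit_flipBit i, flipBit_flipBit i⟩

theorem hadamard_flipBit {n : ℕ} (i : Fin n) (S x : Cube n) :
    hadamard n S (flipBit i x) = (if S i then -1 else 1) * hadamard n S x := by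
  unfold hadamard
  rw [← Finset.mul_prod_erase _ _ (Finset.mem_univ i),
    ← Finset.mul_prod_erase Finset.univ (fun j => hadamardEntry (S j) (x j)) (Finset.mem_univ i),
    ← mul_assoc]
  congr 1
  · simp only [flipBit, Function.update_self, hadamardEntry]
    cases S i <;> cases x i <;> simp
  · refine Finset.prod_congr rfl fun j hj => ?_
    simp [flipBit, Function.update_of_ne (Finset.ne_of_mem_erase hj)]

/-- The Hadamard transform of the query point, with the answer qubit left alone. -/
noncomputable def fourierGate (n : ℕ) : unitaryGroup (Reg n) ℂ :=
  ⟨kroneckerMap (· * ·) (hadamard n) (1 : Matrix Bool Bool ℂ),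
    kronecker_mem_unitary (hadamard_mem_unitaryGroup n) (one_mem _)⟩

theorem fourierGate_mulVec {n : ℕ} (ψ : Reg n → ℂ) (S : Cube n) (b : Bool) :
    ((fourierGate n : Matrix (Reg n) (Reg n) ℂ) *ᵥ ψ) (S, b) =
      ∑ x, hadamard n S x * ψ (x, b) := by
  simp [fourierGate, mulVec, dotProduct, Fintype.sum_prod_type, one_apply]

/-- The amplitude `2^(-n/2)`. -/
noncomputable def uniformAmplitude (n : ℕ) : ℂ := ((√2)⁻¹ : ℝ) ^ n

theorem norm_uniformAmplitude_sq (n : ℕ) : ‖uniformAmplitude n‖ ^ 2 = ((2 : ℝ) ^ n)⁻¹ := by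
  rw [uniformAmplitude, norm_pow, ← pow_mul, mul_comm n 2, pow_mul, Complex.norm_real]
  simp

/-- The uniform quantum example `2^(-n/2) ∑ₓ |x, f(x)⟩`. -/
noncomputable def exampleState {n : ℕ} (f : Cube n → Bool) : Reg n → ℂ :=
  fun v => if v.2 = f v.1 then uniformAmplitude n else 0

theorem fourierGate_mulVec_single (n : ℕ) :
    (fourierGate n : Matrix (Reg n) (Reg n) ℂ) *ᵥ Pi.single (fun _ => false, false) 1 =
      exampleState fun _ => false := by
  ext ⟨S, b⟩
  rw [fourierGate_mulVec]
  cases b <;> simp [exampleState, Pi.single_apply, hadamard, hadamardEntry, uniformAmplitude]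

theorem sum_norm_sq_mulVec {ι : Type*} [Fintype ι] [DecidableEq ι] (U : unitaryGroup ι ℂ)
    (ψ : ι → ℂ) : ∑ v, ‖((U : Matrix ι ι ℂ) *ᵥ ψ) v‖ ^ 2 = ∑ v, ‖ψ v‖ ^ 2 := by
  have key : ∀ φ : ι → ℂ, ((∑ v, ‖φ v‖ ^ 2 : ℝ) : ℂ) = star φ ⬝ᵥ φ := fun φ => by
    simp [dotProduct, ← Complex.normSq_eq_conj_mul_self, Complex.normSq_eq_norm_sq]
  apply Complex.ofReal_injective
  rw [key, key, star_mulVec, dotProduct_mulVec, vecMul_vecMul, ← star_eq_conjTranspose,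
    UnitaryGroup.star_mul_self, vecMul_one]

theorem norm_exampleState_sq {n : ℕ} (f : Cube n → Bool) (v : Reg n) :
    ‖exampleState f v‖ ^ 2 = if v.2 = f v.1 then ((2 : ℝ) ^ n)⁻¹ else 0 := by
  unfold exampleState
  split_ifs <;> simp [norm_uniformAmplitude_sq]

theorem sum_norm_exampleState_sq_mul {n : ℕ} (f : Cube n → Bool) (g : Reg n → ℝ) :
    ∑ v, ‖exampleState f v‖ ^ 2 * g v = (∑ x, g (x, f x)) / 2 ^ n := by
  simp only [norm_exampleState_sq, Fintype.sum_prod_type, ite_mul, zero_mul,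
    Finset.sum_ite_eq', Finset.mem_univ, if_true, ← Finset.mul_sum]
  field_simp

theorem sum_norm_exampleState_sq {n : ℕ} (f : Cube n → Bool) :
    ∑ v, ‖exampleState f v‖ ^ 2 = 1 := by
  simpa using sum_norm_exampleState_sq_mul f fun _ => 1

/-- The number of points at which `f` is sensitive to the `i`-th bit. -/
def sensitiveCount {n : ℕ} (f : Cube n → Bool) (i : Fin n) : ℕ :=
  (Finset.univ.filter fun x : Cube n => f x ≠ f (flipBit i x)).card

/-- The probability of an outcome of Fourier sampling. -/
noncomputable def fourierProb {n : ℕ} (f : Cube n → Bool) (v : Reg n) : ℝ :=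
  ‖((fourierGate n : Matrix (Reg n) (Reg n) ℂ) *ᵥ exampleState f) v‖ ^ 2

theorem fourierProb_nonneg {n : ℕ} (f : Cube n → Bool) (v : Reg n) : 0 ≤ fourierProb f v :=
  sq_nonneg _

theorem sum_fourierProb {n : ℕ} (f : Cube n → Bool) : ∑ v, fourierProb f v = 1 :=
  (sum_norm_sq_mulVec _ _).trans (sum_norm_exampleState_sq f)

/-- A Fourier sample of `f` contains the index `i` with probability half the influence of `i`. -/
theorem sum_fourier_mem {n : ℕ} (f : Cube n → Bool) (i : Fin n) :
    ∑ v : Reg n, (if v.1 i then fourierProb f v else 0) = sensitiveCount f i / 2 ^ n / 2 := by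
  unfold fourierProb
  set q := exampleState f with hq
  -- Flipping bit `i` multiplies the transform at `S` by `-1` if `i ∈ S` and by `1` otherwise. So
  -- the transform of `q - q'` is twice that of `q` on the sets containing `i` and vanishes
  -- elsewhere; the claim is Parseval for `q - q'`.
  set q' : Reg n → ℂ := fun v => q (flipBit i v.1, v.2) with hq'
  have h1 : ∀ v : Reg n, ‖((fourierGate n : Matrix (Reg n) (Reg n) ℂ) *ᵥ (q - q')) v‖ ^ 2 =
      4 * (if v.1 i then
        ‖((fourierGate n : Matrix (Reg n) (Reg n) ℂ) *ᵥ q) v‖ ^ 2 else 0) := by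
    rintro ⟨S, b⟩
    have h2 : ((fourierGate n : Matrix (Reg n) (Reg n) ℂ) *ᵥ q') (S, b) =
        (if S i then -1 else 1) * ((fourierGate n : Matrix (Reg n) (Reg n) ℂ) *ᵥ q) (S, b) := by
      rw [fourierGate_mulVec, fourierGate_mulVec, Finset.mul_sum,
        ← Equiv.sum_comp (flipBitEquiv i)]
      refine Finset.sum_congr rfl fun x _ => ?_
      change hadamard n S (flipBit i x) * q (flipBit i (flipBit i x), b) = _
      rw [hadamard_flipBit, flipBit_flipBit]
      ring
    rw [mulVec_sub, Pi.sub_apply, h2]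
    cases hS : S i
    · simp [hS]
    · simp only [hS, if_true]
      rw [neg_one_mul, sub_neg_eq_add, ← two_mul, norm_mul, mul_pow]
      norm_num
  have h3 := sum_norm_sq_mulVec (fourierGate n) (q - q')
  simp only [h1, ← Finset.mul_sum] at h3
  have h4 : ∑ v, ‖(q - q') v‖ ^ 2 = 2 * (sensitiveCount f i / 2 ^ n : ℝ) := by
    -- At a sensitive `x` the two states put their amplitude on opposite answer bits, so both values
    -- of `b` contribute.
    have h5 : ∀ x : Cube n, ∑ b, ‖(q - q') (x, b)‖ ^ 2 =
        if f x ≠ f (flipBit i x) then 2 * ((2 : ℝ) ^ n)⁻¹ else 0 := by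
      intro x
      simp only [hq', hq, exampleState, Fintype.sum_bool, Pi.sub_apply]
      cases f x <;> cases f (flipBit i x) <;> simp [norm_uniformAmplitude_sq] <;> ring
    rw [Fintype.sum_prod_type]
    simp only [h5]
    rw [← Finset.sum_filter, Finset.sum_const, nsmul_eq_mul, sensitiveCount]
    field_simp
  rw [h4] at h3
  linarith

/-! ### A circuit that stores independently processed examples -/

theorem submatrix_mem_unitaryGroup {ι κ : Type*} [Fintype ι] [DecidableEq ι] [Fintype κ]
    [DecidableEq κ] {A : Matrix κ κ ℂ} (hA : A ∈ unitaryGroup κ ℂ) (e₁ e₂ : ι ≃ κ) :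
    A.submatrix e₁ e₂ ∈ unitaryGroup ι ℂ := by
  rw [mem_unitaryGroup_iff] at hA ⊢
  rw [star_eq_conjTranspose, conjTranspose_submatrix, submatrix_mul_equiv,
    ← star_eq_conjTranspose, hA, submatrix_one_equiv]

/-- Exchange of the first register with the `j`-th slot. -/
def swapSlot {α : Type*} {M : ℕ} (j : Fin M) : Equiv.Perm (α × (Fin M → α)) where
  toFun v := (v.2 j, Function.update v.2 j v.1)
  invFun v := (v.2 j, Function.update v.2 j v.1)
  left_inv v := by simp
  right_inv v := by simp

/-- The permutation of amplitudes induced by a permutation of the basis. -/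
def permGate {ι : Type*} [Fintype ι] [DecidableEq ι] (σ : Equiv.Perm ι) : unitaryGroup ι ℂ :=
  ⟨(1 : Matrix ι ι ℂ).submatrix σ (Equiv.refl ι), submatrix_mem_unitaryGroup (one_mem _) _ _⟩

theorem permGate_mulVec {ι : Type*} [Fintype ι] [DecidableEq ι] (σ : Equiv.Perm ι)
    (ψ : ι → ℂ) : (permGate σ : Matrix ι ι ℂ) *ᵥ ψ = ψ ∘ σ := by
  simp only [permGate]
  rw [submatrix_mulVec_equiv, one_mulVec]
  rfl

/-- The gate that applies `U` to the first register. -/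
def firstGate {ι κ : Type*} [Fintype ι] [DecidableEq ι] [Fintype κ] [DecidableEq κ]
    (U : unitaryGroup ι ℂ) : unitaryGroup (ι × κ) ℂ :=
  ⟨kroneckerMap (· * ·) (U : Matrix ι ι ℂ) (1 : Matrix κ κ ℂ),
    kronecker_mem_unitary U.2 (one_mem _)⟩

theorem firstGate_mulVec {ι κ : Type*} [Fintype ι] [DecidableEq ι] [Fintype κ] [DecidableEq κ]
    (U : unitaryGroup ι ℂ) (φ : ι → ℂ) (ζ : κ → ℂ) :
    (firstGate (κ := κ) U : Matrix (ι × κ) (ι × κ) ℂ) *ᵥ (fun v => φ v.1 * ζ v.2) =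
      fun v => ((U : Matrix ι ι ℂ) *ᵥ φ) v.1 * ζ v.2 := by
  ext ⟨a, z⟩
  simp [firstGate, mulVec, dotProduct, Fintype.sum_prod_type, one_apply, Finset.sum_mul, mul_assoc]

/-- The all-zero basis state of the query register. -/
def zeroReg (n : ℕ) : Reg n := (fun _ => false, false)

/-- The state of the slots when the first `t` of them hold the states `r j`. -/
def slotState {n M : ℕ} (r : Fin M → Reg n → ℂ) (t : ℕ) (z : Fin M → Reg n) : ℂ :=
  ∏ j : Fin M, if (j : ℕ) < t then r j (z j) else (Pi.single (zeroReg n) 1 : Reg n → ℂ) (z j)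

/-- Slot `j` is still zero before step `j`, so the swap stores the processed example there and hands
a clean register back. -/
theorem slotState_swap {n M : ℕ} (r : Fin M → Reg n → ℂ) (j : Fin M) (a : Reg n)
    (z : Fin M → Reg n) :
    r j (z j) * slotState r j (Function.update z j a) =
      (Pi.single (zeroReg n) 1 : Reg n → ℂ) a * slotState r (j + 1) z := by
  unfold slotState
  rw [← Finset.mul_prod_erase _ _ (Finset.mem_univ j),
    ← Finset.mul_prod_erase Finset.univ (fun i : Fin M => if (i : ℕ) < j + 1 then r i (z i) else _)
      (Finset.mem_univ j)]
  have h : ∀ i ∈ Finset.univ.erase j,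
      (if (i : ℕ) < j then r i (Function.update z j a i)
        else (Pi.single (zeroReg n) 1 : Reg n → ℂ) (Function.update z j a i)) =
      if (i : ℕ) < j + 1 then r i (z i) else (Pi.single (zeroReg n) 1 : Reg n → ℂ) (z i) := by
    intro i hi
    have hij := Finset.ne_of_mem_erase hi
    have hij' : (i : ℕ) ≠ j := fun h => hij (Fin.ext h)
    rw [Function.update_of_ne hij]
    exact if_congr (by omega) rfl rfl
  rw [Finset.prod_congr rfl h]
  simp
  ring

/-- The gate between two queries: post-process the answer, store it in a slot and prepare a uniform
superposition of query points. -/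
noncomputable def sampleGate {n M : ℕ} (U : Fin M → unitaryGroup (Reg n) ℂ) (j : Fin M) :
    unitaryGroup (Reg n × (Fin M → Reg n)) ℂ :=
  firstGate (fourierGate n) * (permGate (swapSlot j) * firstGate (U j))

/-- One step of the loop invariant: the state stays a product, one more slot is filled, and the
first register is again a uniform superposition with answer qubit `0`, written as the example state
of the zero function. -/
theorem sampleGate_mulVec {n M : ℕ} (U : Fin M → unitaryGroup (Reg n) ℂ) (j : Fin M)
    (q : Reg n → ℂ) :
    (sampleGate U j : Matrix (Reg n × (Fin M → Reg n)) (Reg n × (Fin M → Reg n)) ℂ) *ᵥ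
      (fun v => q v.1 *
        slotState (fun i => (U i : Matrix (Reg n) (Reg n) ℂ) *ᵥ q) j v.2) =
      fun v => exampleState (fun _ => false) v.1 *
        slotState (fun i => (U i : Matrix (Reg n) (Reg n) ℂ) *ᵥ q) (j + 1) v.2 := by
  simp only [sampleGate, UnitaryGroup.mul_val, ← mulVec_mulVec]
  rw [firstGate_mulVec, permGate_mulVec]
  have h : (fun v : Reg n × (Fin M → Reg n) => ((U j : Matrix (Reg n) (Reg n) ℂ) *ᵥ q) v.1 *
      slotState (fun i => (U i : Matrix (Reg n) (Reg n) ℂ) *ᵥ q) j v.2) ∘ swapSlot j =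
      fun v => (Pi.single (zeroReg n) 1 : Reg n → ℂ) v.1 *
        slotState (fun i => (U i : Matrix (Reg n) (Reg n) ℂ) *ᵥ q) (j + 1) v.2 := by
    ext v
    exact slotState_swap (fun i => (U i : Matrix (Reg n) (Reg n) ℂ) *ᵥ q) j v.1 v.2
  rw [h, firstGate_mulVec, zeroReg, fourierGate_mulVec_single]

/-- Any bijection serves to decode the workspace, provided that it respects the initial state. -/
theorem exists_slotEquiv (n M : ℕ) : ∃ e : (Fin (M * (n + 1)) → Bool) ≃ (Fin M → Reg n),
    e (fun _ => false) = fun _ => zeroReg n := by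
  have h : Fintype.card (Fin (M * (n + 1)) → Bool) = Fintype.card (Fin M → Reg n) := by
    simp only [Fintype.card_pi, Fintype.card_prod, Fintype.card_bool, Finset.prod_const,
      Finset.card_univ, Fintype.card_fin]
    rw [← pow_succ, ← pow_mul, mul_comm]
  exact ⟨(Fintype.equivOfCardEq h).setValue _ _, Equiv.setValue_eq _ _ _⟩

open Classical in
/-- Independent quantum examples can be measured in any bases, one query for each. -/
theorem exists_learner {n M : ℕ} (U : Fin M → unitaryGroup (Reg n) ℂ)
    (G : (Fin M → Reg n) → Cube n → Bool) :
    ∃ A : QuantumLearner n, A.queries = M ∧ ∀ (f : Cube n → Bool) (P : (Cube n → Bool) → Prop),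
      A.probOutput f P = ∑ z, if P (G z) then
        ∏ j, ‖((U j : Matrix (Reg n) (Reg n) ℂ) *ᵥ exampleState f) (z j)‖ ^ 2 else 0 := by
  obtain ⟨e₀, he₀⟩ := exists_slotEquiv n M
  let e : QBasis n (M * (n + 1)) ≃ Reg n × (Fin M → Reg n) :=
    (Equiv.prodAssoc _ _ _).symm.trans (Equiv.prodCongr (Equiv.refl _) e₀)
  let lift : unitaryGroup (Reg n × (Fin M → Reg n)) ℂ →
      unitaryGroup (QBasis n (M * (n + 1))) ℂ :=
    fun W => ⟨W.1.submatrix e e, submatrix_mem_unitaryGroup W.2 e e⟩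
  have hlift : ∀ W (ψ : Reg n × (Fin M → Reg n) → ℂ),
      (lift W).1 *ᵥ (ψ ∘ e) = (W.1 *ᵥ ψ) ∘ e := fun W ψ => by
    change W.1.submatrix e e *ᵥ _ = _
    rw [submatrix_mulVec_equiv, Function.comp_assoc, Equiv.self_comp_symm, Function.comp_id]
  let A : QuantumLearner n :=
    { work := M * (n + 1)
      queries := M
      gate := fun t => match t with
        | 0 => lift (firstGate (fourierGate n))
        | t + 1 => if h : t < M then lift (sampleGate U ⟨t, h⟩) else 1
      output := fun v => G (e v).2 }
  refine ⟨A, rfl, fun f P => ?_⟩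
  set r : Fin M → Reg n → ℂ := fun i => (U i : Matrix (Reg n) (Reg n) ℂ) *ᵥ exampleState f with hr
  have hstate : ∀ t ≤ M, A.state f t =
      (fun v : Reg n × (Fin M → Reg n) =>
        exampleState (fun _ => false) v.1 * slotState r t v.2) ∘ e := by
    intro t
    induction t with
    | zero =>
      intro _
      have h0 : zeroState n (M * (n + 1)) =
          (fun v : Reg n × (Fin M → Reg n) =>
            (Pi.single (zeroReg n) 1 : Reg n → ℂ) v.1 * slotState r 0 v.2) ∘ e := by
        ext v
        obtain ⟨w, rfl⟩ := e.symm.surjective v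
        have hz : e (fun _ => false, false, fun _ => false) = (zeroReg n, fun _ => zeroReg n) :=
          Prod.ext rfl he₀
        rw [Function.comp_apply, Equiv.apply_symm_apply]
        simp only [zeroState, Pi.single_apply, Equiv.symm_apply_eq, hz, slotState, Nat.not_lt_zero,
          if_false]
        rw [Finset.prod_ite_zero]
        simp [Prod.ext_iff, funext_iff, ite_and]
        split_ifs <;> rfl
      change (lift (firstGate (fourierGate n))).1 *ᵥ zeroState n (M * (n + 1)) = _
      rw [h0, hlift, firstGate_mulVec, zeroReg, fourierGate_mulVec_single]
    | succ t ih =>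
      intro ht
      have hg : A.gate (t + 1) = lift (sampleGate U ⟨t, ht⟩) := dif_pos (Nat.lt_of_succ_le ht)
      rw [QuantumLearner.state, ih (by omega), hg]
      have hq : membershipQuery f ((fun v : Reg n × (Fin M → Reg n) =>
          exampleState (fun _ => false) v.1 * slotState r t v.2) ∘ e) =
          (fun v : Reg n × (Fin M → Reg n) => exampleState f v.1 * slotState r t v.2) ∘ e := by
        ext ⟨x, b, w⟩
        change exampleState (fun _ => false) (x, xor b (f x)) * slotState r t (e₀ w) =
          exampleState f (x, b) * slotState r t (e₀ w)
        simp [exampleState]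
      rw [hq]
      exact (hlift _ _).trans (congrArg (· ∘ e) (sampleGate_mulVec U ⟨t, ht⟩ (exampleState f)))
  have hfinal : ∀ z, slotState r M z = ∏ j, r j (z j) := fun z =>
    Finset.prod_congr rfl fun j _ => if_pos j.2
  unfold QuantumLearner.probOutput
  rw [hstate A.queries le_rfl]
  refine (Equiv.sum_comp e fun v : Reg n × (Fin M → Reg n) => if P (G v.2) then
    ‖exampleState (fun _ => false) v.1 * slotState r M v.2‖ ^ 2 else 0).trans ?_
  -- The superposition prepared after the last query is never used; its norm `1` is summed out.
  rw [Fintype.sum_prod_type_right]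
  refine Finset.sum_congr rfl fun z _ => ?_
  by_cases hP : P (G z)
  · simp only [hP, if_true, norm_mul, mul_pow]
    rw [← Finset.sum_mul, sum_norm_exampleState_sq, one_mul, hfinal, norm_prod,
      Finset.prod_pow]
  · simp [hP]

/-! ### Influences and wide terms of a DNF -/

/-- The number of points at which `f` and `h` differ. -/
def diffCount {n : ℕ} (f h : Cube n → Bool) : ℕ :=
  (Finset.univ.filter fun x : Cube n => f x ≠ h x).card

theorem Term.eval_eq_true {n : ℕ} {t : Term n} {x : Cube n} :
    t.eval x = true ↔ ∀ l ∈ t, x l.1 = l.2 := by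
  simp [Term.eval]

theorem DNF.eval_eq_true {n : ℕ} {φ : DNF n} {x : Cube n} :
    φ.eval x = true ↔ ∃ t ∈ φ, t.eval x = true := by
  simp [DNF.eval]

/-- A satisfiable term has no conflicting literals, so it fixes as many coordinates as it has
literals; a contradictory term holds nowhere. -/
theorem card_eval_mul_two_pow_le {n : ℕ} (t : Term n) :
    (Finset.univ.filter fun x : Cube n => t.eval x = true).card * 2 ^ t.card ≤ 2 ^ n := by
  rcases (Finset.univ.filter fun x : Cube n => t.eval x = true).eq_empty_or_nonempty with h | h
  · simp [h]
  obtain ⟨x₀, hx₀⟩ := h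
  rw [Finset.mem_filter, Term.eval_eq_true] at hx₀
  have hT : (t.image Prod.fst).card = t.card := by
    refine Finset.card_image_of_injOn fun l hl l' hl' h => Prod.ext h ?_
    rw [← hx₀.2 l hl, ← hx₀.2 l' hl', h]
  have hsub : (Finset.univ.filter fun x : Cube n => t.eval x = true) ⊆
      Fintype.piFinset fun i => if i ∈ t.image Prod.fst then {x₀ i} else Finset.univ := by
    intro x hx
    rw [Finset.mem_filter, Term.eval_eq_true] at hx
    rw [Fintype.mem_piFinset]
    intro i
    split_ifs with hi
    · obtain ⟨l, hl, rfl⟩ := Finset.mem_image.1 hi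
      rw [Finset.mem_singleton, hx.2 l hl, hx₀.2 l hl]
    · exact Finset.mem_univ _
  have hcard : (Fintype.piFinset fun i => if i ∈ t.image Prod.fst then {x₀ i}
      else (Finset.univ : Finset Bool)).card = 2 ^ (t.image Prod.fst)ᶜ.card := by
    rw [Fintype.card_piFinset, ← Finset.prod_const, ← Finset.prod_subset (Finset.subset_univ _)]
    · refine Finset.prod_congr rfl fun i hi => ?_
      rw [if_neg (Finset.mem_compl.1 hi), Finset.card_univ, Fintype.card_bool]
    · intro i _ hi
      rw [if_pos (Finset.notMem_compl.1 hi), Finset.card_singleton]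
  calc _ ≤ 2 ^ (t.image Prod.fst)ᶜ.card * 2 ^ t.card :=
        Nat.mul_le_mul_right _ ((Finset.card_le_card hsub).trans_eq hcard)
    _ = 2 ^ n := by
        rw [← pow_add, ← hT, Finset.card_compl_add_card, Fintype.card_fin]

/-- Flipping bit `i` pairs the sensitive points, and each pair has one point where `f` is true. -/
theorem sensitiveCount_le {n : ℕ} (f : Cube n → Bool) (i : Fin n) :
    sensitiveCount f i ≤
      2 * (Finset.univ.filter fun x : Cube n => f x = true ∧ f (flipBit i x) = false).card := by
  set A := Finset.univ.filter fun x : Cube n => f x = true ∧ f (flipBit i x) = false with hA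
  have h : (Finset.univ.filter fun x : Cube n => f x ≠ f (flipBit i x)) ⊆
      A ∪ A.image (flipBit i) := by
    intro x hx
    rw [Finset.mem_filter] at hx
    rw [Finset.mem_union, Finset.mem_image]
    cases hfx : f x
    · refine Or.inr ⟨flipBit i x, ?_, flipBit_flipBit i x⟩
      have := hx.2
      rw [hfx] at this
      simpa [hA, flipBit_flipBit, hfx] using this.symm
    · have := hx.2
      rw [hfx] at this
      refine Or.inl ?_
      simpa [hA, hfx] using this.symm
  have h1 := Finset.card_le_card h
  have h2 := Finset.card_union_le A (A.image (flipBit i))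
  have h3 : (A.image (flipBit i)).card ≤ A.card := Finset.card_image_le
  unfold sensitiveCount
  omega

/-- The total influence of a DNF of size `s` is at most `2 s`. -/
theorem sum_sensitiveCount_le {n s : ℕ} {f : Cube n → Bool} (hf : HasDNFSize s f) :
    ∑ i, sensitiveCount f i ≤ 2 * s * 2 ^ n := by
  obtain ⟨φ, hφ, hfφ⟩ := hf
  -- If flipping bit `i` makes `f` false, every term satisfied at `x` must mention `i`.
  have h1 : ∀ i, (Finset.univ.filter fun x : Cube n =>
      f x = true ∧ f (flipBit i x) = false).card ≤
      ∑ t ∈ φ.toFinset, (Finset.univ.filter fun x : Cube n =>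
        t.eval x = true ∧ i ∈ t.image Prod.fst).card := by
    intro i
    refine (Finset.card_le_card fun x hx => ?_).trans Finset.card_biUnion_le
    simp only [Finset.mem_filter, Finset.mem_univ, true_and, ← hfφ, DNF.eval_eq_true] at hx
    obtain ⟨⟨t, ht, htx⟩, hx2⟩ := hx
    rw [Finset.mem_biUnion]
    refine ⟨t, List.mem_toFinset.2 ht, ?_⟩
    simp only [Finset.mem_filter, Finset.mem_univ, true_and]
    refine ⟨htx, ?_⟩
    by_contra hi
    rw [← Bool.not_eq_true, DNF.eval_eq_true] at hx2
    refine hx2 ⟨t, ht, ?_⟩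
    rw [Term.eval_eq_true] at htx ⊢
    intro l hl
    have hli : l.1 ≠ i := fun h => hi (Finset.mem_image.2 ⟨l, hl, h⟩)
    rw [flipBit, Function.update_of_ne hli, htx l hl]
  -- A term of `k` literals contributes at most `k * 2^(n-k)`, and `k ≤ 2^k`.
  have h2 : ∀ t : Term n, ∑ i, (Finset.univ.filter fun x : Cube n =>
      t.eval x = true ∧ i ∈ t.image Prod.fst).card ≤ 2 ^ n := by
    intro t
    have h3 : ∀ i, (Finset.univ.filter fun x : Cube n =>
        t.eval x = true ∧ i ∈ t.image Prod.fst).card = if i ∈ t.image Prod.fst then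
          (Finset.univ.filter fun x : Cube n => t.eval x = true).card else 0 := by
      intro i
      split_ifs with hi <;> simp only [hi, and_true, and_false, Finset.filter_false,
        Finset.card_empty]
    simp only [h3]
    rw [Finset.sum_ite_mem, Finset.univ_inter, Finset.sum_const, smul_eq_mul, mul_comm]
    refine le_trans (Nat.mul_le_mul_left _ ?_) (card_eval_mul_two_pow_le t)
    exact Finset.card_image_le.trans Nat.lt_two_pow_self.le
  calc ∑ i, sensitiveCount f i
      ≤ ∑ i, 2 * ∑ t ∈ φ.toFinset, (Finset.univ.filter fun x : Cube n =>
        t.eval x = true ∧ i ∈ t.image Prod.fst).card :=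
        Finset.sum_le_sum fun i _ => (sensitiveCount_le f i).trans (Nat.mul_le_mul_left _ (h1 i))
    _ = 2 * ∑ t ∈ φ.toFinset, ∑ i, (Finset.univ.filter fun x : Cube n =>
        t.eval x = true ∧ i ∈ t.image Prod.fst).card := by
        rw [← Finset.mul_sum, Finset.sum_comm]
    _ ≤ 2 * ∑ t ∈ φ.toFinset, 2 ^ n :=
        Nat.mul_le_mul_left _ (Finset.sum_le_sum fun t _ => h2 t)
    _ ≤ 2 * s * 2 ^ n := by
        rw [Finset.sum_const, smul_eq_mul, ← mul_assoc]
        gcongr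
        exact (List.toFinset_card_le φ).trans hφ

/-- Dropping the terms with more than `w` literals. -/
theorem diffCount_filter_le {n : ℕ} (φ : DNF n) (w : ℕ) :
    diffCount (DNF.eval φ) (DNF.eval (φ.filter fun t => t.card ≤ w)) * 2 ^ w ≤
      φ.length * 2 ^ n := by
  have h : (Finset.univ.filter fun x : Cube n =>
      DNF.eval φ x ≠ DNF.eval (φ.filter fun t => t.card ≤ w) x) ⊆
      (φ.toFinset.filter fun t => ¬ t.card ≤ w).biUnion fun t =>
        Finset.univ.filter fun x : Cube n => t.eval x = true := by
    intro x hx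
    rw [Finset.mem_filter] at hx
    by_contra hcon
    refine hx.2 (Bool.eq_iff_iff.2 ?_)
    rw [DNF.eval_eq_true, DNF.eval_eq_true]
    constructor
    · rintro ⟨t, ht, htx⟩
      refine ⟨t, List.mem_filter.2 ⟨ht, ?_⟩, htx⟩
      by_contra hw
      refine hcon (Finset.mem_biUnion.2 ⟨t, ?_, by simpa using htx⟩)
      exact Finset.mem_filter.2 ⟨List.mem_toFinset.2 ht, by simpa using hw⟩
    · rintro ⟨t, ht, htx⟩
      exact ⟨t, (List.mem_filter.1 ht).1, htx⟩
  calc _ ≤ (∑ t ∈ φ.toFinset.filter fun t => ¬ t.card ≤ w,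
        (Finset.univ.filter fun x : Cube n => t.eval x = true).card) * 2 ^ w :=
        Nat.mul_le_mul_right _ ((Finset.card_le_card h).trans Finset.card_biUnion_le)
    _ ≤ ∑ t ∈ φ.toFinset.filter fun t => ¬ t.card ≤ w, 2 ^ n := by
        rw [Finset.sum_mul]
        refine Finset.sum_le_sum fun t ht => le_trans (Nat.mul_le_mul_left _ ?_)
          (card_eval_mul_two_pow_le t)
        exact Nat.pow_le_pow_right (by norm_num) (not_le.1 (Finset.mem_filter.1 ht).2).le
    _ ≤ φ.length * 2 ^ n := by
        rw [Finset.sum_const, smul_eq_mul]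
        gcongr
        exact (Finset.card_filter_le _ _).trans (List.toFinset_card_le φ)

/-! ### Fixing variables of small influence -/

/-- The point that agrees with `a` on `L` and with `x` elsewhere. -/
def mix {n : ℕ} (L : Finset (Fin n)) (a x : Cube n) : Cube n := fun i => if i ∈ L then a i else x i

/-- For independent uniform `a` and `x` the mixed point is uniform: exchanging the coordinates in
`L` is an involution on pairs. -/
theorem sum_mix {n : ℕ} (L : Finset (Fin n)) (g : Cube n → ℕ) :
    ∑ a, ∑ x, g (mix L a x) = 2 ^ n * ∑ x, g x := by
  have hinv : Function.Involutive fun p : Cube n × Cube n => (mix L p.2 p.1, mix L p.1 p.2) := by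
    intro p
    ext i <;> simp only [mix] <;> split_ifs <;> rfl
  rw [← Fintype.sum_prod_type' fun a x => g (mix L a x),
    ← Equiv.sum_comp (Function.Involutive.toPerm _ hinv)]
  have : ∀ p : Cube n × Cube n, g (mix L (Function.Involutive.toPerm _ hinv p).1
      (Function.Involutive.toPerm _ hinv p).2) = g p.2 := by
    intro p
    exact congrArg g (congrArg Prod.snd (hinv p))
  simp only [this]
  rw [Fintype.sum_prod_type]
  simp

/-- Hybrid argument: the coordinates in `L` are rerandomised one at a time. Each step either leaves
a uniform point unchanged or flips bit `i`, so it alters `f` with probability at most the influence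
of `i`. -/
theorem sum_ne_mix_le {n : ℕ} (f : Cube n → Bool) (L : Finset (Fin n)) :
    ∑ a, ∑ x, (if f x ≠ f (mix L a x) then 1 else 0) ≤ 2 ^ n * ∑ i ∈ L, sensitiveCount f i := by
  induction L using Finset.induction_on with
  | empty => simp [show ∀ a x : Cube n, mix ∅ a x = x from fun a x => by ext; simp [mix]]
  | insert i L hi ih =>
    have h : ∀ a x, (if f x ≠ f (mix (insert i L) a x) then 1 else 0) ≤
        (if f (mix L a x) ≠ f (flipBit i (mix L a x)) then 1 else 0) +
          if f x ≠ f (mix L a x) then 1 else 0 := by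
      intro a x
      have h1 : mix (insert i L) a x = mix L a x ∨
          mix (insert i L) a x = flipBit i (mix L a x) := by
        have h2 : mix (insert i L) a x = Function.update (mix L a x) i (a i) := by
          ext j
          by_cases hj : j = i
          · subst hj; simp [mix]
          · simp [mix, hj]
        rw [h2, flipBit]
        by_cases hai : a i = mix L a x i
        · left; rw [hai, Function.update_eq_self]
        · right; congr 1; revert hai; cases a i <;> cases mix L a x i <;> simp
      rcases h1 with h1 | h1 <;> rw [h1]
      · omega
      · by_cases h3 : f x = f (mix L a x)
        · rw [← h3]; omega
        · rw [if_pos h3]; split_ifs <;> omega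
    calc _ ≤ ∑ a, ∑ x, ((if f (mix L a x) ≠ f (flipBit i (mix L a x)) then 1 else 0) +
          if f x ≠ f (mix L a x) then 1 else 0) :=
          Finset.sum_le_sum fun a _ => Finset.sum_le_sum fun x _ => h a x
      _ ≤ _ := by
          simp only [Finset.sum_add_distrib]
          rw [sum_mix L fun y => if f y ≠ f (flipBit i y) then 1 else 0, Finset.sum_insert hi,
            mul_add, sensitiveCount, Finset.card_filter]
          exact Nat.add_le_add_left ih _

/-- Some restriction of `h` on the coordinates in `L` is close to `f`, if `h` is and the
coordinates in `L` have little influence on `f`. -/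
theorem exists_diffCount_mix_le {n : ℕ} (f h : Cube n → Bool) (L : Finset (Fin n)) :
    ∃ a, diffCount f (fun x => h (mix L a x)) ≤ diffCount f h + ∑ i ∈ L, sensitiveCount f i := by
  -- Averaging over `a`: by the triangle inequality through `f (mix L a x)`, a uniform mixed point
  -- accounts for `diffCount f h`, and rerandomisation for the influences.
  have key : ∑ a : Cube n, diffCount f (fun x => h (mix L a x)) ≤
      ∑ _a : Cube n, (diffCount f h + ∑ i ∈ L, sensitiveCount f i) := by
    have h1 : ∀ a x, (if f x ≠ h (mix L a x) then 1 else 0) ≤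
        (if f (mix L a x) ≠ h (mix L a x) then 1 else 0) +
          if f x ≠ f (mix L a x) then 1 else 0 := by
      intro a x
      by_cases h3 : f x = f (mix L a x)
      · rw [← h3]; omega
      · rw [if_pos h3]; split_ifs <;> omega
    calc _ ≤ ∑ a, ∑ x, ((if f (mix L a x) ≠ h (mix L a x) then 1 else 0) +
          if f x ≠ f (mix L a x) then 1 else 0) := by
          simp only [diffCount, Finset.card_filter]
          exact Finset.sum_le_sum fun a _ => Finset.sum_le_sum fun x _ => h1 a x
      _ ≤ _ := by
          simp only [Finset.sum_add_distrib]
          rw [sum_mix L fun y => if f y ≠ h y then 1 else 0]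
          have := sum_ne_mix_le f L
          simp only [Finset.sum_const, Finset.card_univ, smul_eq_mul, diffCount,
            Finset.card_filter]
          simpa using this
  obtain ⟨a, -, ha⟩ := Finset.exists_le_of_sum_le Finset.univ_nonempty key
  exact ⟨a, ha⟩

/-! ### A finite class of narrow hypotheses -/

/-- A literal over the variables in `V`, or a constant. -/
abbrev ExtLiteral {n : ℕ} (V : Finset (Fin n)) : Type := (V × Bool) ⊕ Bool

/-- The value of a literal or constant. -/
def ExtLiteral.eval {n : ℕ} {V : Finset (Fin n)} (x : Cube n) : ExtLiteral V → Bool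
  | .inl l => x l.1 == l.2
  | .inr b => b

/-- DNF expressions over `V` with `s` terms, each of `w` literals or constants. -/
abbrev Code {n : ℕ} (V : Finset (Fin n)) (s w : ℕ) : Type := Fin s → Fin w → ExtLiteral V

/-- The Boolean function denoted by a code. -/
def Code.eval {n s w : ℕ} {V : Finset (Fin n)} (c : Code V s w) (x : Cube n) : Bool :=
  decide (∃ j, ∀ k, (c j k).eval x = true)

theorem exists_termCode {n w : ℕ} {V L : Finset (Fin n)} (a : Cube n) (t : Term n)
    (hw : t.card ≤ w) (hV : ∀ l ∈ t, l.1 ∉ L → l.1 ∈ V) :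
    ∃ u : Fin w → ExtLiteral V, ∀ x, (∀ k, (u k).eval x = true) ↔ t.eval (mix L a x) = true := by
  have hl : ∀ l : Fin n × Bool, ∃ e : ExtLiteral V,
      l ∈ t → ∀ x, e.eval x = true ↔ mix L a x l.1 = l.2 := by
    intro l
    by_cases hL : l.1 ∈ L
    · exact ⟨.inr (a l.1 == l.2), fun _ x => by simp [ExtLiteral.eval, mix, hL]⟩
    · by_cases ht : l ∈ t
      · exact ⟨.inl (⟨l.1, hV l ht hL⟩, l.2), fun _ x => by simp [ExtLiteral.eval, mix, hL]⟩
      · exact ⟨.inr true, fun h => absurd h ht⟩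
  choose e he using hl
  -- Unused positions hold the constant `true`, which is neutral in a conjunction.
  refine ⟨fun k => if h : (k : ℕ) < t.toList.length then e t.toList[k] else .inr true,
    fun x => ?_⟩
  rw [Term.eval_eq_true]
  constructor
  · intro h l hlt
    obtain ⟨k, hk, rfl⟩ := List.getElem_of_mem (Finset.mem_toList.2 hlt)
    have hkw : k < w := hk.trans_le (by rwa [Finset.length_toList])
    have := h ⟨k, hkw⟩
    simp only [dif_pos hk] at this
    exact (he _ hlt x).1 this
  · intro h k
    by_cases hk : (k : ℕ) < t.toList.length
    · simp only [dif_pos hk]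
      have hm : t.toList[(k : ℕ)] ∈ t := Finset.mem_toList.1 (List.getElem_mem hk)
      exact (he _ hm x).2 (h _ hm)
    · simp only [dif_neg hk]
      rfl

theorem exists_code {n s w : ℕ} (hw : 0 < w) {V L : Finset (Fin n)} (a : Cube n) (φ : DNF n)
    (hs : φ.length ≤ s) (hφ : ∀ t ∈ φ, t.card ≤ w)
    (hV : ∀ t ∈ φ, ∀ l ∈ t, l.1 ∉ L → l.1 ∈ V) :
    ∃ c : Code V s w, ∀ x, c.eval x = φ.eval (mix L a x) := by
  have hu : ∀ t : Term n, ∃ u : Fin w → ExtLiteral V,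
      t ∈ φ → ∀ x, (∀ k, (u k).eval x = true) ↔ t.eval (mix L a x) = true := by
    intro t
    by_cases ht : t ∈ φ
    · obtain ⟨u, hu⟩ := exists_termCode (V := V) (L := L) a t (hφ t ht) (hV t ht)
      exact ⟨u, fun _ => hu⟩
    · exact ⟨fun _ => .inr true, fun h => absurd h ht⟩
  choose u hu using hu
  -- Missing terms are padded with `false`; this needs `0 < w`, since an empty conjunction would be
  -- true.
  refine ⟨fun j => if h : (j : ℕ) < φ.length then u φ[j] else fun _ => .inr false, fun x => ?_⟩
  rw [Bool.eq_iff_iff, DNF.eval_eq_true, Code.eval, decide_eq_true_iff]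
  constructor
  · rintro ⟨j, hj⟩
    by_cases h : (j : ℕ) < φ.length
    · simp only [dif_pos h] at hj
      exact ⟨φ[(j : ℕ)], List.getElem_mem h, (hu _ (List.getElem_mem h) x).1 hj⟩
    · simp only [dif_neg h] at hj
      exact absurd (hj ⟨0, hw⟩) (by simp [ExtLiteral.eval])
  · rintro ⟨t, ht, htx⟩
    obtain ⟨j, hj, rfl⟩ := List.getElem_of_mem ht
    refine ⟨⟨j, hj.trans_le hs⟩, ?_⟩
    simp only [dif_pos hj]
    exact (hu _ ht x).2 htx

/-- A DNF is close to a narrow DNF over any set of variables that contains the influential ones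
among some few variables. -/
theorem exists_relevant {n s w : ℕ} (hw : 0 < w) {f : Cube n → Bool} (hf : HasDNFSize s f) :
    ∃ R : Finset (Fin n), R.card ≤ s * w ∧ ∀ V : Finset (Fin n), ∃ c : Code V s w,
      disagreement f c.eval ≤
        (s : ℝ) / 2 ^ w + ∑ i ∈ R \ V, (sensitiveCount f i : ℝ) / 2 ^ n := by
  obtain ⟨φ, hφ, hfφ⟩ := hf
  obtain rfl : DNF.eval φ = f := funext hfφ
  set ψ : DNF n := φ.filter fun t => t.card ≤ w with hψ
  have hψw : ∀ t ∈ ψ, t.card ≤ w := fun t ht => by simpa using (List.mem_filter.1 ht).2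
  have hψs : ψ.length ≤ s := (List.length_filter_le _ _).trans hφ
  -- `R` is chosen before `V`, so that it can be compared with a random set of candidates.
  refine ⟨ψ.toFinset.biUnion fun t => t.image Prod.fst, ?_, fun V => ?_⟩
  · refine (Finset.card_biUnion_le_card_mul _ _ w fun t ht => Finset.card_image_le.trans
      (hψw t (List.mem_toFinset.1 ht))).trans ?_
    exact Nat.mul_le_mul_right _ ((List.toFinset_card_le ψ).trans hψs)
  set L := (ψ.toFinset.biUnion fun t => t.image Prod.fst) \ V with hL
  obtain ⟨a, ha⟩ := exists_diffCount_mix_le (DNF.eval φ) (DNF.eval ψ) L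
  obtain ⟨c, hc⟩ := exists_code (s := s) hw (V := V) (L := L) a ψ hψs hψw fun t ht l hl hlL => by
    by_contra hlV
    refine hlL (Finset.mem_sdiff.2 ⟨Finset.mem_biUnion.2 ⟨t, List.mem_toFinset.2 ht, ?_⟩, hlV⟩)
    exact Finset.mem_image_of_mem _ hl
  refine ⟨c, ?_⟩
  have h1 : disagreement (DNF.eval φ) c.eval =
      (diffCount (DNF.eval φ) fun x => DNF.eval ψ (mix L a x)) / 2 ^ n := by
    rw [show c.eval = fun x => DNF.eval ψ (mix L a x) from funext hc]
    rfl
  have h2 : (diffCount (DNF.eval φ) (DNF.eval ψ) : ℝ) / 2 ^ n ≤ s / 2 ^ w := by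
    rw [div_le_div_iff₀ (by positivity) (by positivity)]
    exact_mod_cast (diffCount_filter_le φ w).trans (Nat.mul_le_mul_right _ hφ)
  rw [h1, ← Finset.sum_div]
  calc _ ≤ ((diffCount (DNF.eval φ) (DNF.eval ψ) : ℝ) +
        ∑ i ∈ L, (sensitiveCount (DNF.eval φ) i : ℝ)) / 2 ^ n := by
        gcongr
        exact_mod_cast ha
    _ ≤ _ := by
        rw [add_div]
        gcongr

/-! ### Concentration and union bounds for finite product distributions -/

theorem sum_pi_prod {α : Type*} [Fintype α] {m : ℕ} (q : Fin m → α → ℝ) :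
    ∑ z : Fin m → α, ∏ j, q j (z j) = ∏ j, ∑ a, q j a := by
  classical
  rw [Finset.prod_univ_sum, Fintype.piFinset_univ]

theorem sum_forall_not {α : Type*} [Fintype α] (m : ℕ) (p : α → ℝ) (hp : ∑ a, p a = 1)
    (E : α → Prop) [DecidablePred E] [∀ z : Fin m → α, Decidable (∀ j, ¬ E (z j))] :
    ∑ z : Fin m → α, (if ∀ j, ¬ E (z j) then ∏ j, p (z j) else 0) =
      (1 - ∑ a, if E a then p a else 0) ^ m := by
  have h : ∀ z : Fin m → α, (if ∀ j, ¬ E (z j) then ∏ j, p (z j) else 0) =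
      ∏ j, if E (z j) then 0 else p (z j) := by
    intro z
    split_ifs with hz
    · exact Finset.prod_congr rfl fun j _ => (if_neg (hz j)).symm
    · push Not at hz
      obtain ⟨j, hj⟩ := hz
      exact (Finset.prod_eq_zero (f := fun j => if E (z j) then 0 else p (z j))
        (Finset.mem_univ j) (if_pos hj)).symm
  simp only [h]
  rw [sum_pi_prod fun _ a => if E a then 0 else p a, Finset.prod_const, Finset.card_univ,
    Fintype.card_fin, ← hp, ← Finset.sum_sub_distrib]
  congr 1
  refine Finset.sum_congr rfl fun a _ => ?_
  split_ifs <;> simp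

/-- A Chernoff bound for sums of independent centred variables. -/
theorem sum_le_exp_of_centered {α : Type*} [Fintype α] (m : ℕ) {p : α → ℝ} (hp0 : ∀ a, 0 ≤ p a)
    (hp : ∑ a, p a = 1) {g : α → ℝ} (hg : ∀ a, |g a| ≤ 1) (hg0 : ∑ a, p a * g a = 0) {η : ℝ}
    (hη0 : 0 ≤ η) (hη : η ≤ 2) :
    ∑ z : Fin m → α, (if m * η ≤ ∑ j, g (z j) then ∏ j, p (z j) else 0) ≤
      Real.exp (-(m * η ^ 2 / 4)) := by
  -- The parameter `λ = η/2` minimises `λ² - λη`. The hypothesis `η ≤ 2` keeps the exponent in `[-1,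
  -- 1]`, where `exp y ≤ 1 + y + y²`.
  have h1 : ∑ a, p a * Real.exp (η / 2 * g a) ≤ Real.exp ((η / 2) ^ 2) := by
    have h2 : ∀ a, p a * Real.exp (η / 2 * g a) ≤
        p a + η / 2 * (p a * g a) + (η / 2) ^ 2 * p a := by
      intro a
      have h3 : |η / 2 * g a| ≤ 1 := by
        rw [abs_mul, abs_of_nonneg (by linarith)]
        exact mul_le_one₀ (by linarith) (abs_nonneg _) (hg a)
      have h4 := (abs_le.1 (Real.abs_exp_sub_one_sub_id_le h3)).2
      have h5 : (g a) ^ 2 ≤ 1 := (sq_le_one_iff_abs_le_one _).2 (hg a)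
      have h6 : Real.exp (η / 2 * g a) ≤ 1 + η / 2 * g a + (η / 2) ^ 2 := by
        have := mul_le_mul_of_nonneg_left h5 (sq_nonneg (η / 2))
        nlinarith
      have := mul_le_mul_of_nonneg_left h6 (hp0 a)
      linarith
    calc _ ≤ ∑ a, (p a + η / 2 * (p a * g a) + (η / 2) ^ 2 * p a) :=
          Finset.sum_le_sum fun a _ => h2 a
      _ = (η / 2) ^ 2 + 1 := by
          rw [Finset.sum_add_distrib, Finset.sum_add_distrib, ← Finset.mul_sum, ← Finset.mul_sum,
            hp, hg0]
          ring
      _ ≤ _ := Real.add_one_le_exp _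
  have h7 : ∀ z : Fin m → α, (if m * η ≤ ∑ j, g (z j) then ∏ j, p (z j) else 0) ≤
      Real.exp (-(m * (η ^ 2 / 2))) * ∏ j, p (z j) * Real.exp (η / 2 * g (z j)) := by
    intro z
    rw [Finset.prod_mul_distrib, ← Real.exp_sum, mul_left_comm, ← Real.exp_add, ← Finset.mul_sum]
    have hz : 0 ≤ ∏ j, p (z j) := Finset.prod_nonneg fun j _ => hp0 _
    split_ifs with h
    · refine le_mul_of_one_le_right hz (Real.one_le_exp ?_)
      nlinarith [mul_le_mul_of_nonneg_left h (show 0 ≤ η / 2 by linarith)]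
    · exact mul_nonneg hz (Real.exp_pos _).le
  calc _ ≤ ∑ z : Fin m → α,
        Real.exp (-(m * (η ^ 2 / 2))) * ∏ j, p (z j) * Real.exp (η / 2 * g (z j)) :=
        Finset.sum_le_sum fun z _ => h7 z
    _ = Real.exp (-(m * (η ^ 2 / 2))) * (∑ a, p a * Real.exp (η / 2 * g a)) ^ m := by
        rw [← Finset.mul_sum, sum_pi_prod fun _ a => p a * Real.exp (η / 2 * g a),
          Finset.prod_const, Finset.card_univ, Fintype.card_fin]
    _ ≤ Real.exp (-(m * (η ^ 2 / 2))) * Real.exp ((η / 2) ^ 2) ^ m := by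
        gcongr
        exact Finset.sum_nonneg fun a _ => mul_nonneg (hp0 a) (Real.exp_pos _).le
    _ = _ := by
        rw [← Real.exp_nat_mul, ← Real.exp_add]
        congr 1
        ring

theorem sum_le_two_mul_exp_of_centered {α : Type*} [Fintype α] (m : ℕ) {p : α → ℝ}
    (hp0 : ∀ a, 0 ≤ p a) (hp : ∑ a, p a = 1) {g : α → ℝ} (hg : ∀ a, |g a| ≤ 1)
    (hg0 : ∑ a, p a * g a = 0) {η : ℝ} (hη0 : 0 ≤ η) (hη : η ≤ 2) :
    ∑ z : Fin m → α, (if m * η ≤ |∑ j, g (z j)| then ∏ j, p (z j) else 0) ≤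
      2 * Real.exp (-(m * η ^ 2 / 4)) := by
  have h1 := sum_le_exp_of_centered m hp0 hp hg hg0 hη0 hη
  have h2 := sum_le_exp_of_centered m hp0 hp (g := fun a => -g a) (by simpa using hg)
    (by simpa using hg0) hη0 hη
  rw [two_mul]
  refine le_trans ?_ (add_le_add h1 h2)
  rw [← Finset.sum_add_distrib]
  refine Finset.sum_le_sum fun z _ => ?_
  have hz : 0 ≤ ∏ j, p (z j) := Finset.prod_nonneg fun j _ => hp0 _
  rw [Finset.sum_neg_distrib]
  by_cases h : m * η ≤ |∑ j, g (z j)|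
  · rw [if_pos h]
    rcases le_abs.1 h with h | h <;> rw [if_pos h] <;> split_ifs <;> linarith
  · rw [if_neg h]
    split_ifs <;> linarith

theorem sum_exists_le {α κ : Type*} [Fintype α] [Fintype κ] {p : α → ℝ} (hp : ∀ a, 0 ≤ p a)
    (E : κ → α → Prop) [∀ c a, Decidable (E c a)] [∀ a, Decidable (∃ c, E c a)] :
    ∑ a, (if ∃ c, E c a then p a else 0) ≤ ∑ c, ∑ a, if E c a then p a else 0 := by
  rw [Finset.sum_comm]
  refine Finset.sum_le_sum fun a _ => ?_
  have h0 : ∀ c ∈ Finset.univ, 0 ≤ if E c a then p a else 0 := fun c _ => by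
    split_ifs
    exacts [hp a, le_rfl]
  split_ifs with h
  · obtain ⟨c, hc⟩ := h
    refine le_trans (if_pos hc).ge (Finset.single_le_sum h0 (Finset.mem_univ c))
  · exact Finset.sum_nonneg h0

/-- Union bound for a two-stage experiment: the second bad event may depend on the first outcome,
provided that its probability is bounded uniformly. -/
theorem one_sub_le_sum_sum {α β : Type*} [Fintype α] [Fintype β] {p : α → ℝ} {q : β → ℝ}
    (hp0 : ∀ a, 0 ≤ p a) (hp : ∑ a, p a = 1) (hq0 : ∀ b, 0 ≤ q b) (hq : ∑ b, q b = 1)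
    {A : α → Prop} {B G : α → β → Prop} [DecidablePred A] [∀ a b, Decidable (B a b)]
    [∀ a b, Decidable (G a b)] (hG : ∀ a b, ¬ A a → ¬ B a b → G a b) {δ₁ δ₂ : ℝ}
    (hA : ∑ a, (if A a then p a else 0) ≤ δ₁) (hB : ∀ a, ∑ b, (if B a b then q b else 0) ≤ δ₂) :
    1 - δ₁ - δ₂ ≤ ∑ a, ∑ b, if G a b then p a * q b else 0 := by
  have h1 : ∀ a b, p a * q b - (if A a then p a else 0) * q b -
      p a * (if B a b then q b else 0) ≤ if G a b then p a * q b else 0 := by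
    intro a b
    have h2 := mul_nonneg (hp0 a) (hq0 b)
    by_cases hAa : A a
    · rw [if_pos hAa]
      split_ifs <;> linarith
    · by_cases hBa : B a b
      · rw [if_pos hBa, if_neg hAa]
        split_ifs <;> linarith
      · rw [if_pos (hG a b hAa hBa), if_neg hBa, if_neg hAa]
        linarith
  refine le_trans ?_ (Finset.sum_le_sum fun a _ => Finset.sum_le_sum fun b _ => h1 a b)
  simp only [Finset.sum_sub_distrib, ← Finset.mul_sum, hq, mul_one, hp]
  have h3 : ∑ a, p a * ∑ b, (if B a b then q b else 0) ≤ δ₂ :=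
    calc _ ≤ ∑ a, p a * δ₂ :=
          Finset.sum_le_sum fun a _ => mul_le_mul_of_nonneg_left (hB a) (hp0 a)
      _ = δ₂ := by rw [← Finset.sum_mul, hp, one_mul]
  linarith

/-! ### Finding the influential variables -/

open Classical in
/-- Measuring some quantum examples in the Fourier basis and others in the computational basis. -/
theorem exists_twoStageLearner {n m₁ m₂ : ℕ}
    (G : (Fin m₁ → Reg n) → (Fin m₂ → Reg n) → Cube n → Bool) :
    ∃ A : QuantumLearner n, A.queries = m₁ + m₂ ∧
      ∀ (f : Cube n → Bool) (P : (Cube n → Bool) → Prop),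
        A.probOutput f P = ∑ z₁, ∑ z₂, if P (G z₁ z₂) then
          (∏ j, ‖((fourierGate n : Matrix (Reg n) (Reg n) ℂ) *ᵥ exampleState f) (z₁ j)‖ ^ 2) *
            ∏ j, ‖exampleState f (z₂ j)‖ ^ 2 else 0 := by
  obtain ⟨A, hA, hAP⟩ := exists_learner
    (Fin.append (fun _ : Fin m₁ => fourierGate n) fun _ : Fin m₂ => 1)
    (fun z => G (fun j => z (Fin.castAdd m₂ j)) fun j => z (Fin.natAdd m₁ j))
  refine ⟨A, hA, fun f P => ?_⟩
  rw [hAP, ← Equiv.sum_comp (Fin.appendEquiv m₁ m₂), Fintype.sum_prod_type]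
  refine Finset.sum_congr rfl fun z₁ _ => Finset.sum_congr rfl fun z₂ _ => ?_
  simp [Fin.appendEquiv, Fin.prod_univ_add]

/-- The set of indices of the ones of the query point. -/
def Reg.support {n : ℕ} (v : Reg n) : Finset (Fin n) := Finset.univ.filter fun i => v.1 i = true

/-- The support, if it has at most `d` elements. -/
def Reg.smallSupport {n : ℕ} (d : ℕ) (v : Reg n) : Finset (Fin n) :=
  if v.support.card ≤ d then v.support else ∅

theorem Reg.mem_smallSupport {n d : ℕ} {v : Reg n} {i : Fin n} :
    i ∈ Reg.smallSupport d v ↔ v.1 i = true ∧ (Reg.support v).card ≤ d := by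
  unfold Reg.smallSupport
  split_ifs with h
  · exact ⟨fun hi => ⟨(Finset.mem_filter.1 hi).2, h⟩,
      fun hi => Finset.mem_filter.2 ⟨Finset.mem_univ i, hi.1⟩⟩
  · exact ⟨fun hi => absurd hi (Finset.notMem_empty i), fun hi => absurd hi.2 h⟩

/-- The expected size of a Fourier sample is half the total influence. -/
theorem sum_fourierProb_mul_card {n s : ℕ} {f : Cube n → Bool} (hf : HasDNFSize s f) :
    ∑ v, fourierProb f v * v.support.card ≤ s := by
  have h1 : ∀ v : Reg n, fourierProb f v * v.support.card =
      ∑ i, if v.1 i then fourierProb f v else 0 := by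
    intro v
    rw [← Finset.sum_filter, Finset.sum_const, nsmul_eq_mul, mul_comm]
    rfl
  simp only [h1]
  rw [Finset.sum_comm, Finset.sum_congr rfl (fun i _ => sum_fourier_mem f i), ← Finset.sum_div,
    ← Finset.sum_div, div_div, div_le_iff₀ (by positivity)]
  have h2 : ((∑ i, sensitiveCount f i : ℕ) : ℝ) ≤ (2 * s * 2 ^ n : ℕ) := by
    exact_mod_cast sum_sensitiveCount_le hf
  push_cast at h2
  linarith

/-- Influential variables occur in Fourier samples of bounded size. -/
theorem le_sum_fourierProb {n s d : ℕ} {f : Cube n → Bool} (hf : HasDNFSize s f) {τ : ℝ}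
    (hd : 4 * s ≤ τ * d) (hd0 : 0 < d) {i : Fin n} (hi : τ ≤ sensitiveCount f i / 2 ^ n) :
    τ / 4 ≤ ∑ v : Reg n, if i ∈ Reg.smallSupport d v then fourierProb f v else 0 := by
  have hd0' : (0 : ℝ) < d := by exact_mod_cast hd0
  -- Markov's inequality in pointwise form: discarding samples larger than `d` loses probability at
  -- most `s / d ≤ τ / 4` out of `τ / 2`.
  have h1 : ∀ v : Reg n, (if v.1 i then fourierProb f v else 0) -
      fourierProb f v * v.support.card / d ≤
      if i ∈ Reg.smallSupport d v then fourierProb f v else 0 := by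
    intro v
    have hv := fourierProb_nonneg f v
    have h2 : 0 ≤ fourierProb f v * v.support.card / d := by positivity
    by_cases hvi : v.1 i = true
    · by_cases hvd : v.support.card ≤ d
      · rw [if_pos hvi, if_pos (Reg.mem_smallSupport.2 ⟨hvi, hvd⟩)]
        linarith
      · rw [if_pos hvi, if_neg fun h => hvd (Reg.mem_smallSupport.1 h).2, sub_nonpos, le_div_iff₀ hd0']
        gcongr
        exact (not_le.1 hvd).le
    · rw [if_neg hvi, if_neg fun h => hvi (Reg.mem_smallSupport.1 h).1]
      linarith
  refine le_trans ?_ (Finset.sum_le_sum fun v _ => h1 v)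
  rw [Finset.sum_sub_distrib, ← Finset.sum_div]
  have h3 : (∑ v, fourierProb f v * v.support.card) / d ≤ τ / 4 := by
    rw [div_le_iff₀ hd0']
    have := sum_fourierProb_mul_card hf
    linarith
  rw [sum_fourier_mem]
  linarith

/-- The variables seen in the Fourier samples of size at most `d`. -/
def candidates {n m : ℕ} (d : ℕ) (z : Fin m → Reg n) : Finset (Fin n) :=
  Finset.univ.biUnion fun j => Reg.smallSupport d (z j)

theorem card_candidates_le {n m : ℕ} (d : ℕ) (z : Fin m → Reg n) :
    (candidates d z).card ≤ m * d := by
  refine (Finset.card_biUnion_le_card_mul _ _ d fun j _ => ?_).trans_eq (by simp)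
  unfold Reg.smallSupport
  split_ifs with h
  · exact h
  · simp

/-! ### Empirical error minimisation -/

/-- The number of examples on which `h` errs. -/
def errorCount {n m : ℕ} (h : Cube n → Bool) (z : Fin m → Reg n) : ℕ :=
  (Finset.univ.filter fun j => (z j).2 ≠ h (z j).1).card

/-- Measured in the computational basis, an example is a classical pair `(x, f(x))` with `x`
uniform, so the Chernoff bound applies to the centred error indicators. -/
theorem sum_errorCount_deviation_le {n : ℕ} (m : ℕ) (f h : Cube n → Bool) {η : ℝ} (hη0 : 0 ≤ η)
    (hη : η ≤ 2) :
    ∑ z : Fin m → Reg n, (if m * η ≤ |errorCount h z - m * disagreement f h| then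
      ∏ j, ‖exampleState f (z j)‖ ^ 2 else 0) ≤ 2 * Real.exp (-(m * η ^ 2 / 4)) := by
  set μ := disagreement f h with hμ
  set g : Reg n → ℝ := fun v => (if v.2 ≠ h v.1 then 1 else 0) - μ with hg
  have hμ0 : 0 ≤ μ := by rw [hμ, disagreement]; positivity
  have hμ1 : μ ≤ 1 := by
    rw [hμ, disagreement, div_le_one (by positivity)]
    have := Finset.card_le_univ (Finset.univ.filter fun x : Cube n => f x ≠ h x)
    simp only [Fintype.card_pi, Fintype.card_bool, Finset.prod_const, Finset.card_univ,
      Fintype.card_fin] at this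
    exact_mod_cast this
  have hg1 : ∀ v, |g v| ≤ 1 := by
    intro v
    rw [abs_le, hg]
    dsimp only
    split_ifs <;> constructor <;> linarith
  have hg0 : ∑ v, ‖exampleState f v‖ ^ 2 * g v = 0 := by
    rw [sum_norm_exampleState_sq_mul, hg]
    simp only [Finset.sum_sub_distrib, Finset.sum_boole, Finset.sum_const, Finset.card_univ,
      nsmul_eq_mul]
    rw [sub_div, hμ, disagreement]
    simp
  have hsum : ∀ z : Fin m → Reg n, ∑ j, g (z j) = errorCount h z - m * μ := by
    intro z
    simp only [hg, errorCount, Finset.sum_sub_distrib, Finset.sum_boole, Finset.sum_const,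
      Finset.card_univ, Fintype.card_fin, nsmul_eq_mul]
  simp only [← hsum]
  exact sum_le_two_mul_exp_of_centered m (fun v => sq_nonneg _) (sum_norm_exampleState_sq f) hg1
    hg0 hη0 hη

theorem card_code {n : ℕ} (V : Finset (Fin n)) (s w : ℕ) :
    Fintype.card (Code V s w) = (2 * V.card + 2) ^ (s * w) := by
  simp [← pow_mul, mul_comm]

theorem exists_min_errorCount {n m s w : ℕ} (V : Finset (Fin n)) (z : Fin m → Reg n) :
    ∃ c : Code V s w, ∀ c' : Code V s w, errorCount c.eval z ≤ errorCount c'.eval z :=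
  haveI : Nonempty (Code V s w) := ⟨fun _ _ => .inr true⟩
  Finite.exists_min fun c : Code V s w => errorCount c.eval z

/-- The learner takes `m₁` Fourier samples to find the influential variables and fits a narrow DNF
over these to `m₂` random examples. -/
theorem exists_learnsDNF {n s w d m₁ m₂ : ℕ} {ε δ : ℝ} (hs : 0 < s) (hw : 0 < w) (hm₂ : 0 < m₂)
    (hε0 : 0 < ε) (hε1 : ε < 1) (hwε : (s : ℝ) / 2 ^ w ≤ ε / 8)
    (hd : 32 * (s : ℝ) ^ 2 * w ≤ ε * d)
    (hm₁ : s * w * Real.exp (-(ε * m₁ / (32 * s * w))) ≤ δ / 2)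
    (hδ : (2 * (m₁ * d) + 2 : ℝ) ^ (s * w) * (2 * Real.exp (-(m₂ * ε ^ 2 / 64))) ≤ δ / 2) :
    ∃ A : QuantumLearner n, A.LearnsDNF s ε δ ∧ A.queries = m₁ + m₂ := by
  classical
  choose best hbest using fun (z₁ : Fin m₁ → Reg n) (z₂ : Fin m₂ → Reg n) =>
    exists_min_errorCount (s := s) (w := w) (candidates d z₁) z₂
  obtain ⟨A, hA, hAP⟩ := exists_twoStageLearner fun (z₁ : Fin m₁ → Reg n) (z₂ : Fin m₂ → Reg n) =>
    (best z₁ z₂).eval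
  refine ⟨A, fun f hf => ?_, hA⟩
  have hs' : (0 : ℝ) < s := by exact_mod_cast hs
  have hw' : (0 : ℝ) < w := by exact_mod_cast hw
  have hm₂' : (0 : ℝ) < m₂ := by exact_mod_cast hm₂
  have hd0 : 0 < d := by
    rcases Nat.eq_zero_or_pos d with rfl | h
    · have : 0 < 32 * (s : ℝ) ^ 2 * w := by positivity
      simp at hd
      linarith
    · exact h
  -- With this threshold the at most `s * w` relevant variables of smaller influence cost at most `ε
  -- / 8` together.
  set τ : ℝ := ε / (8 * (s * w)) with hτ
  have hτ0 : 0 < τ := by positivity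
  have hdτ : 4 * s ≤ τ * d := by
    rw [hτ, div_mul_eq_mul_div, le_div_iff₀ (by positivity)]
    linarith
  obtain ⟨R, hR, hRc⟩ := exists_relevant hw hf
  have hR' : (R.card : ℝ) ≤ s * w := by exact_mod_cast hR
  let R' : Finset (Fin n) := R.filter fun i => τ ≤ sensitiveCount f i / 2 ^ n
  have hprod0 : ∀ z : Fin m₁ → Reg n, 0 ≤ ∏ j, fourierProb f (z j) := fun z =>
    Finset.prod_nonneg fun j _ => fourierProb_nonneg f _
  have hq0 : ∀ z : Fin m₂ → Reg n, 0 ≤ ∏ j, ‖exampleState f (z j)‖ ^ 2 := fun z =>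
    Finset.prod_nonneg fun j _ => sq_nonneg _
  -- First failure: an influential relevant variable is missed. Each is missed with probability at
  -- most `(1 - τ/4)^m₁`.
  have hA1 : ∑ z : Fin m₁ → Reg n, (if ∃ i : R', ∀ j, (i : Fin n) ∉ Reg.smallSupport d (z j) then
      ∏ j, fourierProb f (z j) else 0) ≤ δ / 2 := by
    refine (sum_exists_le hprod0 fun (i : R') z => ∀ j, (i : Fin n) ∉ Reg.smallSupport d (z j)).trans ?_
    have h1 : ∀ i : R', ∑ z : Fin m₁ → Reg n, (if ∀ j, (i : Fin n) ∉ Reg.smallSupport d (z j) then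
        ∏ j, fourierProb f (z j) else 0) ≤ Real.exp (-(ε * m₁ / (32 * s * w))) := by
      intro i
      have h2 := le_sum_fourierProb hf hdτ hd0 (Finset.mem_filter.1 i.2).2
      have h3 : ∑ v, (if (i : Fin n) ∈ Reg.smallSupport d v then fourierProb f v else 0) ≤ 1 := by
        rw [← sum_fourierProb f]
        refine Finset.sum_le_sum fun v _ => ?_
        split_ifs
        exacts [le_rfl, fourierProb_nonneg f v]
      rw [sum_forall_not m₁ _ (sum_fourierProb f) fun v => (i : Fin n) ∈ Reg.smallSupport d v]
      calc _ ≤ Real.exp (-(τ / 4)) ^ m₁ := by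
            refine pow_le_pow_left₀ (by linarith) ?_ m₁
            refine le_trans ?_ (Real.one_sub_le_exp_neg _)
            exact sub_le_sub_left h2 1
        _ = _ := by
            rw [← Real.exp_nat_mul, hτ]
            congr 1
            field_simp
            ring
    refine (Finset.sum_le_sum fun i _ => h1 i).trans ?_
    rw [Finset.sum_const, nsmul_eq_mul, Finset.card_univ, Fintype.card_coe]
    refine le_trans ?_ hm₁
    gcongr
    refine le_trans ?_ hR'
    exact_mod_cast Finset.card_filter_le _ _
  -- Second failure: some code has an empirical error off by `ε/4` or more. Once `z₁` is fixed, the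
  -- class of codes is fixed too, so a union bound over it is legitimate.
  have hB1 : ∀ z₁ : Fin m₁ → Reg n, ∑ z₂ : Fin m₂ → Reg n,
      (if ∃ c : Code (candidates d z₁) s w,
        m₂ * (ε / 4) ≤ |errorCount c.eval z₂ - m₂ * disagreement f c.eval| then
        ∏ j, ‖exampleState f (z₂ j)‖ ^ 2 else 0) ≤ δ / 2 := by
    intro z₁
    refine (sum_exists_le hq0 fun (c : Code (candidates d z₁) s w) (z₂ : Fin m₂ → Reg n) =>
      m₂ * (ε / 4) ≤ |errorCount c.eval z₂ - m₂ * disagreement f c.eval|).trans ?_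
    refine (Finset.sum_le_sum fun c _ => sum_errorCount_deviation_le m₂ f c.eval
      (by linarith) (by linarith)).trans ?_
    rw [Finset.sum_const, nsmul_eq_mul, Finset.card_univ, card_code]
    refine le_trans ?_ hδ
    rw [show m₂ * (ε / 4) ^ 2 / 4 = m₂ * ε ^ 2 / 64 by ring]
    push_cast
    gcongr
    exact_mod_cast card_candidates_le d z₁
  -- Error budget: `ε/8` for wide terms, `ε/8` for fixed variables, and a deviation `ε/4` for each
  -- of the good code and the chosen one, in all at most `3ε/4`.
  have hgood : ∀ (z₁ : Fin m₁ → Reg n) (z₂ : Fin m₂ → Reg n),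
      (¬ ∃ i : R', ∀ j, (i : Fin n) ∉ Reg.smallSupport d (z₁ j)) →
      (¬ ∃ c : Code (candidates d z₁) s w,
        m₂ * (ε / 4) ≤ |errorCount c.eval z₂ - m₂ * disagreement f c.eval|) →
      disagreement f (best z₁ z₂).eval < ε := by
    intro z₁ z₂ h1 h2
    push Not at h1 h2
    obtain ⟨c, hc⟩ := hRc (candidates d z₁)
    have h3 : ∑ i ∈ R \ candidates d z₁, (sensitiveCount f i : ℝ) / 2 ^ n ≤ ε / 8 := by
      have h4 : ∀ i ∈ R \ candidates d z₁, (sensitiveCount f i : ℝ) / 2 ^ n ≤ τ := by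
        intro i hi
        rw [Finset.mem_sdiff] at hi
        by_contra hcon
        obtain ⟨j, hj⟩ := h1 ⟨i, Finset.mem_filter.2 ⟨hi.1, (not_le.1 hcon).le⟩⟩
        exact hi.2 (Finset.mem_biUnion.2 ⟨j, Finset.mem_univ j, hj⟩)
      calc _ ≤ ((R \ candidates d z₁).card : ℝ) * τ := by
            rw [← nsmul_eq_mul]
            exact Finset.sum_le_card_nsmul _ _ _ h4
        _ ≤ (s * w) * τ := by
            gcongr
            refine le_trans ?_ hR'
            exact_mod_cast Finset.card_le_card Finset.sdiff_subset
        _ = ε / 8 := by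
            rw [hτ]
            field_simp
    have h5 := (abs_lt.1 (h2 c)).2
    have h6 := (abs_lt.1 (h2 (best z₁ z₂))).1
    have h7 : (errorCount (best z₁ z₂).eval z₂ : ℝ) ≤ errorCount c.eval z₂ := by
      exact_mod_cast hbest z₁ z₂ c
    have h8 : m₂ * disagreement f c.eval ≤ m₂ * (ε / 4) :=
      mul_le_mul_of_nonneg_left (by linarith) hm₂'.le
    refine lt_of_mul_lt_mul_left ?_ hm₂'.le
    have h9 : 0 < m₂ * ε := by positivity
    linarith
  rw [hAP]
  have hsum₁ : ∑ z : Fin m₁ → Reg n, ∏ j, fourierProb f (z j) = 1 := by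
    rw [sum_pi_prod fun _ => fourierProb f]
    simp [sum_fourierProb]
  have hsum₂ : ∑ z : Fin m₂ → Reg n, ∏ j, ‖exampleState f (z j)‖ ^ 2 = 1 := by
    rw [sum_pi_prod fun _ v => ‖exampleState f v‖ ^ 2]
    simp [sum_norm_exampleState_sq]
  have := one_sub_le_sum_sum hprod0 hsum₁ hq0 hsum₂ hgood hA1 hB1
  calc 1 - δ = 1 - δ / 2 - δ / 2 := by ring
    _ ≤ _ := this

/-! ### Choice of parameters -/

theorem two_pow_le_exp (k : ℕ) : (2 : ℝ) ^ k ≤ Real.exp k := by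
  have h : (2 : ℝ) ≤ Real.exp 1 := by linarith [Real.add_one_le_exp (1 : ℝ)]
  calc (2 : ℝ) ^ k ≤ Real.exp 1 ^ k := pow_le_pow_left₀ (by norm_num) h k
    _ = Real.exp k := by rw [← Real.exp_nat_mul, mul_one]

/-- `K` is `log₂ X` rounded up; since `log₂ X > 1`, it is at most `2 log₂ X`, and `2 / log 2 < 3`.
-/
theorem exists_nat_log_bound {X : ℝ} (hX : 2 < X) :
    ∃ K : ℕ, 1 ≤ K ∧ X ≤ 2 ^ K ∧ (K : ℝ) ≤ 3 * Real.log X := by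
  have hlog : Real.log 2 < Real.log X := Real.log_lt_log (by norm_num) hX
  have h2 : 0.69 < Real.log 2 := by linarith [Real.log_two_gt_d9]
  have hb : 1 < Real.logb 2 X := by
    rw [Real.logb, one_lt_div (by linarith)]
    exact hlog
  refine ⟨⌈Real.logb 2 X⌉₊, Nat.one_le_ceil_iff.2 (by linarith), ?_, ?_⟩
  · rw [← Real.rpow_natCast, ← Real.logb_le_iff_le_rpow (by norm_num) (by linarith)]
    exact Nat.le_ceil _
  · have h3 := (Nat.ceil_lt_add_one (show 0 ≤ Real.logb 2 X by linarith)).le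
    have h4 : Real.logb 2 X * Real.log 2 = Real.log X := by
      rw [Real.logb]
      field_simp
    nlinarith

/-- Suitable parameters for the learner, in terms of a bound `2 ^ K` on `2 s / (ε δ)`. -/
theorem exists_learnsDNF_of_le_two_pow {n s K : ℕ} {ε δ : ℝ} (hs : 1 ≤ s) (hε0 : 0 < ε)
    (hε1 : ε < 1) (hδ0 : 0 < δ) (hδ1 : δ < 1) (hK : 1 ≤ K) (hX : 2 * s / (ε * δ) ≤ 2 ^ K) :
    ∃ A : QuantumLearner n, A.LearnsDNF s ε δ ∧
      (A.queries : ℝ) ≤ 5505 * (K ^ 2 * (s / ε ^ 2)) + 481 * (K ^ 2 * (s / ε)) := by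
  have hs1 : (1 : ℝ) ≤ s := by exact_mod_cast hs
  have hK1 : (1 : ℝ) ≤ K := by exact_mod_cast hK
  have hX' : 2 * s ≤ 2 ^ K * (ε * δ) := (div_le_iff₀ (by positivity)).1 hX
  have hP : (1 : ℝ) ≤ 2 ^ K := one_le_pow₀ (by norm_num)
  have hsε : 2 * s ≤ 2 ^ K * ε := hX'.trans (by
    gcongr
    exact mul_le_of_le_one_right hε0.le hδ1.le)
  have hsδ : 2 * s ≤ 2 ^ K * δ := hX'.trans (by
    gcongr
    exact mul_le_of_le_one_left hδ0.le hε1.le)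
  have hsK : (s : ℝ) ≤ 2 ^ K := by nlinarith
  have hsεK : s / ε ≤ 2 ^ K := by
    rw [div_le_iff₀ hε0]
    linarith
  set w : ℕ := K + 2 with hw
  have hw2 : (w : ℝ) ≤ 2 ^ (K + 2) := by exact_mod_cast Nat.lt_two_pow_self.le
  have hwK : (w : ℝ) ≤ 3 * K := by
    rw [hw]
    push_cast
    linarith
  -- `m₁` makes the miss exponent at least `2K + 3`, enough for `s * w ≤ δ/2 * 2^(2K+3)`. In `m₂`,
  -- `7K + 21` is the logarithm of a crude bound on `2 * m₁ * d + 2`, and `K + 1` absorbs the factor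
  -- `2` and `δ/2`.
  set d : ℕ := ⌈32 * (s : ℝ) ^ 2 * w / ε⌉₊ with hd
  set m₁ : ℕ := ⌈32 * s * w * (2 * K + 3) / ε⌉₊ with hm₁
  set m₂ : ℕ := ⌈64 * ((7 * K + 21) * (s * w) + K + 1) / ε ^ 2⌉₊ with hm₂
  have hdle : (d : ℝ) ≤ 2 ^ (3 * K + 8) := by
    have h1 := (Nat.ceil_lt_add_one (show 0 ≤ 32 * (s : ℝ) ^ 2 * w / ε by positivity)).le
    have h2 : 32 * (s : ℝ) ^ 2 * w / ε ≤ 2 ^ (3 * K + 7) :=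
      calc 32 * (s : ℝ) ^ 2 * w / ε = 32 * s * (s / ε) * w := by ring
        _ ≤ 32 * 2 ^ K * 2 ^ K * 2 ^ (K + 2) := by gcongr
        _ = 2 ^ (3 * K + 7) := by ring
    have h3 : (1 : ℝ) ≤ 2 ^ (3 * K + 7) := one_le_pow₀ (by norm_num)
    have h4 : (2 : ℝ) ^ (3 * K + 8) = 2 ^ (3 * K + 7) + 2 ^ (3 * K + 7) := by ring
    linarith
  have hm₁le : (m₁ : ℝ) ≤ 2 ^ (4 * K + 11) := by
    have h1 := (Nat.ceil_lt_add_one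
      (show 0 ≤ 32 * (s : ℝ) * w * (2 * K + 3) / ε by positivity)).le
    have h0 : (2 * K + 3 : ℝ) ≤ 2 ^ (2 * K + 3) := by
      exact_mod_cast (Nat.lt_two_pow_self (n := 2 * K + 3)).le
    have h2 : 32 * (s : ℝ) * w * (2 * K + 3) / ε ≤ 2 ^ (4 * K + 10) :=
      calc 32 * (s : ℝ) * w * (2 * K + 3) / ε = 32 * (s / ε) * w * (2 * K + 3) := by ring
        _ ≤ 32 * 2 ^ K * 2 ^ (K + 2) * 2 ^ (2 * K + 3) := by gcongr
        _ = 2 ^ (4 * K + 10) := by ring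
    have h3 : (1 : ℝ) ≤ 2 ^ (4 * K + 10) := one_le_pow₀ (by norm_num)
    have h4 : (2 : ℝ) ^ (4 * K + 11) = 2 ^ (4 * K + 10) + 2 ^ (4 * K + 10) := by ring
    linarith
  have hVle : (2 * (m₁ * d) + 2 : ℝ) ≤ 2 ^ (7 * K + 21) :=
    calc (2 * (m₁ * d) + 2 : ℝ) ≤ 2 * (2 ^ (4 * K + 11) * 2 ^ (3 * K + 8)) + 2 := by gcongr
      _ = 2 ^ (7 * K + 20) + 2 ^ 1 := by ring
      _ ≤ 2 ^ (7 * K + 20) + 2 ^ (7 * K + 20) := by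
          gcongr
          · norm_num
          · omega
      _ = 2 ^ (7 * K + 21) := by ring
  have hm₂pos : 0 < m₂ := Nat.ceil_pos.2 (by positivity)
  have hwε : (s : ℝ) / 2 ^ w ≤ ε / 8 := by
    rw [div_le_iff₀ (by positivity)]
    have : (2 : ℝ) ^ w = 4 * 2 ^ K := by rw [hw]; ring
    rw [this]
    linarith
  have hdε : 32 * (s : ℝ) ^ 2 * w ≤ ε * d := by
    rw [mul_comm ε]
    exact (div_le_iff₀ hε0).1 (Nat.le_ceil _)
  have hmiss : s * w * Real.exp (-(ε * m₁ / (32 * s * w))) ≤ δ / 2 := by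
    have h1 : (2 * K + 3 : ℝ) ≤ ε * m₁ / (32 * s * w) := by
      have h2 := (div_le_iff₀ hε0).1 (Nat.le_ceil (32 * (s : ℝ) * w * (2 * K + 3) / ε))
      rw [le_div_iff₀ (by positivity)]
      linarith
    have h3 : (2 : ℝ) ^ (2 * K + 3) ≤ Real.exp (ε * m₁ / (32 * s * w)) := by
      refine (two_pow_le_exp _).trans (Real.exp_le_exp.2 ?_)
      push_cast
      exact h1
    rw [Real.exp_neg, ← div_eq_mul_inv, div_le_iff₀ (Real.exp_pos _)]
    calc (s : ℝ) * w ≤ (2 ^ K * δ / 2) * 2 ^ (K + 2) := by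
          gcongr
          linarith
      _ ≤ δ / 2 * 2 ^ (2 * K + 3) := by
          have : 0 < δ * (2 : ℝ) ^ (2 * K) := by positivity
          ring_nf at this ⊢
          linarith
      _ ≤ _ := by gcongr
  have hdev : (2 * (m₁ * d) + 2 : ℝ) ^ (s * w) * (2 * Real.exp (-(m₂ * ε ^ 2 / 64))) ≤ δ / 2 := by
    have h1 : (((7 * K + 21) * (s * w) + K + 1 : ℕ) : ℝ) ≤ m₂ * ε ^ 2 / 64 := by
      have h2 := (div_le_iff₀ (by positivity)).1
        (Nat.le_ceil (64 * ((7 * K + 21) * (s * w) + K + 1) / ε ^ 2))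
      push_cast
      linarith
    have h3 : (2 : ℝ) ^ ((7 * K + 21) * (s * w) + K + 1) ≤ Real.exp (m₂ * ε ^ 2 / 64) :=
      (two_pow_le_exp _).trans (Real.exp_le_exp.2 h1)
    rw [Real.exp_neg, ← mul_assoc, ← div_eq_mul_inv, div_le_iff₀ (Real.exp_pos _)]
    have h4 : 2 ≤ δ / 2 * 2 ^ (K + 1) := by
      rw [pow_succ]
      linarith
    calc _ ≤ (2 ^ (7 * K + 21)) ^ (s * w) * (δ / 2 * 2 ^ (K + 1)) := by gcongr
      _ = δ / 2 * 2 ^ ((7 * K + 21) * (s * w) + K + 1) := by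
          rw [← pow_mul, add_assoc, pow_add _ ((7 * K + 21) * (s * w))]
          ring
      _ ≤ _ := by gcongr
  obtain ⟨A, hA, hAq⟩ := exists_learnsDNF (n := n) hs (by omega) hm₂pos hε0 hε1 hwε hdε hmiss hdev
  refine ⟨A, hA, ?_⟩
  rw [hAq]
  push_cast
  have hKs : 1 ≤ (K : ℝ) ^ 2 * s := one_le_mul_of_one_le_of_one_le (one_le_pow₀ hK1) hs1
  -- `481 = 32 * 15 + 1`, the `1` coming from the ceiling.
  have h1 : (m₁ : ℝ) ≤ 481 * (K ^ 2 * (s / ε)) := by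
    refine (Nat.ceil_lt_add_one (by positivity)).le.trans ?_
    rw [← mul_div_assoc, ← mul_div_assoc, div_add_one hε0.ne']
    gcongr
    have : (s : ℝ) * w * (2 * K + 3) ≤ s * (3 * K) * (5 * K) := by
      gcongr
      linarith
    nlinarith
  -- `5505 = 64 * (84 + 2) + 1`: `84` from `28K * 3K`, `2` from `K + 1`, and `1` from the ceiling.
  have h2 : (m₂ : ℝ) ≤ 5505 * (K ^ 2 * (s / ε ^ 2)) := by
    refine (Nat.ceil_lt_add_one (by positivity)).le.trans ?_
    rw [← mul_div_assoc, ← mul_div_assoc, div_add_one (by positivity)]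
    gcongr
    have h3 : (7 * K + 21 : ℝ) * (s * w) ≤ (28 * K) * (s * (3 * K)) := by
      gcongr
      linarith
    have h4 : (K : ℝ) ≤ K ^ 2 * s := by nlinarith
    have h5 : ε ^ 2 ≤ 1 := pow_le_one₀ hε0.le hε1.le
    nlinarith
  linarith

end QDNF

theorem mainTheorem2 :
    ∃ (C : ℝ) (k : ℕ), 0 < C ∧
      ∀ (n s : ℕ) (ε δ : ℝ), 1 ≤ s → 0 < ε → ε < 1 → 0 < δ → δ < 1 →
        ∃ A : QDNF.QuantumLearner n,
          A.LearnsDNF s ε δ ∧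
          (A.queries : ℝ) ≤
            C * ((s : ℝ) ^ 3 / ε + (s : ℝ) ^ 2 / ε ^ 2) * Real.log (2 * s / (ε * δ)) ^ k := by
  -- The factor `9` and the exponent `2` come from `K ≤ 3 log(2s/(εδ))`, squared.
  refine ⟨5505 * 9, 2, by norm_num, fun n s ε δ hs hε0 hε1 hδ0 hδ1 => ?_⟩
  have hs1 : (1 : ℝ) ≤ s := by exact_mod_cast hs
  have hX : 2 < 2 * s / (ε * δ) := by
    rw [lt_div_iff₀ (by positivity)]
    have : ε * δ < 1 := mul_lt_one_of_nonneg_of_lt_one_left hε0.le hε1 hδ1.le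
    linarith
  obtain ⟨K, hK1, hXK, hKlog⟩ := QDNF.exists_nat_log_bound hX
  obtain ⟨A, hA, hAq⟩ := QDNF.exists_learnsDNF_of_le_two_pow (n := n) hs hε0 hε1 hδ0 hδ1 hK1 hXK
  refine ⟨A, hA, hAq.trans ?_⟩
  have hlog : (K : ℝ) ^ 2 ≤ 9 * Real.log (2 * s / (ε * δ)) ^ 2 := by
    calc (K : ℝ) ^ 2 ≤ (3 * Real.log (2 * s / (ε * δ))) ^ 2 := by gcongr
      _ = _ := by ring
  have h3 : (s : ℝ) ≤ s ^ 3 := le_self_pow₀ hs1 (by norm_num)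
  have h2 : (s : ℝ) ≤ s ^ 2 := le_self_pow₀ hs1 (by norm_num)
  calc 5505 * ((K : ℝ) ^ 2 * (s / ε ^ 2)) + 481 * (K ^ 2 * (s / ε))
      ≤ 5505 * ((K : ℝ) ^ 2 * (s / ε ^ 2)) + 5505 * (K ^ 2 * (s / ε)) := by
        gcongr
        norm_num
    _ = 5505 * (s / ε + s / ε ^ 2) * K ^ 2 := by ring
    _ ≤ 5505 * ((s : ℝ) ^ 3 / ε + (s : ℝ) ^ 2 / ε ^ 2) *
        (9 * Real.log (2 * s / (ε * δ)) ^ 2) := by gcongr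
    _ = _ := by ring
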